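/- Let $\mathcal S$, $\mathcal T$, $\mathcal A$ be finite sets of non-terminal states, terminal states and actions, put $\mathcal S^+=\mathcal S\sqcup\mathcal T$, and let $\mathcal P:\mathcal S\times\mathcal A\to\Delta(\mathcal S^+)$ be a transition function, $\mathcal R:\mathcal S^+\to\mathbb R$ a reward function with $\mathcal R(s)<0$ for all $s\in\mathcal S$, $\mu:\mathcal S\to\Delta(\mathcal A)$ a default policy and $\lambda>0$ a temperature. Let $\mathcal P^\mu(s'\mid s)=\sum_a\mu(a\mid s)\mathcal P(s'\mid s,a)$. Let $D_S\in\mathbb R^{\mathcal S\times\mathcal S}$ and $D_T\in\mathbb R^{\mathcal S\times\mathcal T}$ be the matrices with entries $e^{\mathcal R(s)/\lambda}\mathcal P^\mu(s'\mid s)$ for $s'\in\mathcal S$ and $s'\in\mathcal T$ respectively. The terminal representation (TR) is $M=(I-D_S)^{-1}D_T$. For $N\in\mathbb R^{\mathcal S\times\mathcal T}$ let $N^+$ be its extension to $\mathcal S^+\times\mathcal T$ by $N^+(\sigma,\tau)=\mathbb 1_{\sigma=\tau}$ for $\sigma\in\mathcal T$, and write $N(s)$, $N^+(s)$ for rows.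 On a probability space with filtration $(\mathcal F_t)_{t\ge 0}$, consider samples $(s_t,a_t,r_t,s_t')$, where $s_t\in\mathcal S$ is $\mathcal F_t$-measurable and $a_t\in\mathcal A$, $r_t\in\mathbb R$ and the observed successor $s'_t\in\mathcal S^+$ are $\mathcal F_{t+1}$-measurable, such that almost surely $$\mathbb P(a_t=a,\ s_t'=y\mid\mathcal F_t)=\mu(a\mid s_t)\,\mathcal P(y\mid s_t,a)\qquad(a\in\mathcal A,\ y\in\mathcal S^+),$$ $$\mathbb E[e^{r_t/\lambda}\mid\mathcal F_t,s_t']=e^{\mathcal R(s_t)/\lambda},\qquad \mathbb E[e^{2r_t/\lambda}]<\infty,\qquad \mathbb E[e^{2r_t/\lambda}\mid\mathcal F_t]\le C$$ for all $t$, with a constant $C$. (The reward conditions hold in particular if $r_t=\mathcal R(s_t)$. The way $s_{t+1}$ is chosen is unrestricted; in particular one may have $s_{t+1}=s_t'$ as long as $s_t'$ is non-terminal, with an arbitrary restart after termination.) Let the step sizes $\alpha_t\ge 0$ be $\mathcal F_t$-measurable and such that almost surely $$\sum_{t:\,s_t=s}\alpha_t=\infty\ \text{ for every } s\in\mathcal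 S,\qquad \sum_t\alpha_t^2<\infty .$$ Let $\widehat M_0\in\mathbb R^{\mathcal S\times\mathcal T}$ be $\mathcal F_0$-measurable, and let $\widehat M_{t+1}$ arise from $\widehat M_t$ by replacing the row of $s_t$ by $$(1-\alpha_t)\widehat M_t(s_t)+\alpha_t e^{r_t/\lambda}\,\widehat M_t^+(s_t'),$$ all other rows being unchanged. Then $\widehat M_t\to M$ almost surely as $t\to\infty$. -/

import Mathlib

open MeasureTheory Filter Topology

/-- A linearly-solvable Markov decision process with finite sets `S` of non-terminal states, `T` of
terminal states and `A` of actions, together with the temperature `temp` (usually written `λ`).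
The full state set is `S ⊕ T`.  Terminal states have no outgoing transitions, so `P` is indexed by
non-terminal states only. -/
structure LMDP (S T A : Type*) [Fintype S] [Fintype T] [Fintype A] where
  /-- `P s a y` is the probability of moving to `y` when action `a` is taken in `s`. -/
  P : S → A → S ⊕ T → ℝ
  P_nonneg : ∀ s a y, 0 ≤ P s a y
  P_sum : ∀ s a, ∑ y, P s a y = 1
  /-- The state reward. -/
  R : S ⊕ T → ℝ
  R_neg : ∀ s : S, R (Sum.inl s) < 0
  /-- `defaultPolicy s a` is the probability that the default policy picks `a` in `s`. -/
  defaultPolicy : S → A → ℝ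
  defaultPolicy_nonneg : ∀ s a, 0 ≤ defaultPolicy s a
  defaultPolicy_sum : ∀ s, ∑ a, defaultPolicy s a = 1
  /-- The temperature. -/
  temp : ℝ
  temp_pos : 0 < temp

namespace LMDP

variable {S T A : Type*} [Fintype S] [Fintype T] [Fintype A]

/-- The transition kernel induced by the default policy. -/
def kernel (L : LMDP S T A) (s : S) (y : S ⊕ T) : ℝ :=
  ∑ a, L.defaultPolicy s a * L.P s a y

/-- The restriction of the default kernel to non-terminal successors. -/
def PS (L : LMDP S T A) : Matrix S S ℝ := Matrix.of fun s x => L.kernel s (Sum.inl x)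

/-- The restriction of the default kernel to terminal successors. -/
def PT (L : LMDP S T A) : Matrix S T ℝ := Matrix.of fun s τ => L.kernel s (Sum.inr τ)

/-- The diagonal matrix of exponentiated rewards of the non-terminal states. -/
noncomputable def RS [DecidableEq S] (L : LMDP S T A) : Matrix S S ℝ :=
  Matrix.diagonal fun s => Real.exp (L.R (Sum.inl s) / L.temp)

/-- The non-terminal dynamics matrix. -/
noncomputable def DS [DecidableEq S] (L : LMDP S T A) : Matrix S S ℝ := L.RS * L.PS

/-- The terminal dynamics matrix. -/
noncomputable def DT [DecidableEq S] (L : LMDP S T A) : Matrix S T ℝ := L.RS * L.PT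

/-- The terminal representation.  The inverse is a genuine one, see `isUnit_one_sub_DS`. -/
noncomputable def terminalRep [DecidableEq S] (L : LMDP S T A) : Matrix S T ℝ :=
  (1 - L.DS)⁻¹ * L.DT

theorem kernel_nonneg (L : LMDP S T A) (s : S) (y : S ⊕ T) : 0 ≤ L.kernel s y :=
  Finset.sum_nonneg fun a _ => mul_nonneg (L.defaultPolicy_nonneg s a) (L.P_nonneg s a y)

theorem kernel_sum (L : LMDP S T A) (s : S) : ∑ y, L.kernel s y = 1 := by
  unfold kernel
  rw [Finset.sum_comm]
  simp only [← Finset.mul_sum, L.P_sum, mul_one, L.defaultPolicy_sum]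

/-- The matrix inverted in the definition of the terminal representation is invertible. -/
theorem isUnit_one_sub_DS [DecidableEq S] (L : LMDP S T A) : IsUnit (1 - L.DS) := by
  rw [Matrix.isUnit_iff_isUnit_det, isUnit_iff_ne_zero]
  apply det_ne_zero_of_sum_row_lt_diag
  intro k
  have hg : Real.exp (L.R (Sum.inl k) / L.temp) < 1 :=
    Real.exp_lt_one_iff.mpr (div_neg_of_neg_of_pos (L.R_neg k) L.temp_pos)
  have hg0 := Real.exp_pos (L.R (Sum.inl k) / L.temp)
  have hD : ∀ j, L.DS k j = Real.exp (L.R (Sum.inl k) / L.temp) * L.kernel k (Sum.inl j) := by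
    intro j
    simp [DS, RS, PS, Matrix.diagonal_mul]
  have hDn : ∀ j, 0 ≤ L.DS k j := fun j => by
    rw [hD]; exact mul_nonneg hg0.le (L.kernel_nonneg _ _)
  have hsum : ∑ j, L.DS k j < 1 := by
    have h1 : ∑ j, L.kernel k (Sum.inl j) ≤ 1 := by
      rw [← L.kernel_sum k, Fintype.sum_sum_type]
      exact le_add_of_nonneg_right (Finset.sum_nonneg fun _ _ => L.kernel_nonneg _ _)
    simp only [hD, ← Finset.mul_sum]
    nlinarith
  have hoff : ∑ j ∈ Finset.univ.erase k, ‖(1 - L.DS) k j‖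
      = ∑ j ∈ Finset.univ.erase k, L.DS k j := by
    refine Finset.sum_congr rfl fun j hj => ?_
    have hjk : k ≠ j := (Finset.ne_of_mem_erase hj).symm
    rw [Matrix.sub_apply, Matrix.one_apply_ne hjk, zero_sub, norm_neg, Real.norm_eq_abs,
      abs_of_nonneg (hDn j)]
  have hsplit := Finset.add_sum_erase Finset.univ (fun j => L.DS k j) (Finset.mem_univ k)
  rw [hoff, Matrix.sub_apply, Matrix.one_apply_eq, Real.norm_eq_abs]
  refine lt_of_lt_of_le ?_ (le_abs_self _)
  linarith

/-- The extension `M⁺` of a matrix `M` to all states: the row of a terminal state is the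
corresponding unit vector. -/
def extend [DecidableEq T] (M : Matrix S T ℝ) : S ⊕ T → T → ℝ
  | Sum.inl x => M x
  | Sum.inr σ => fun τ => if σ = τ then 1 else 0

/-- The sample-based iteration along one realization: at step `t` only the row of `s t` changes, to
`(1 - α t) • M (s t) + α t * exp (r t / λ) • M⁺ (s' t)`, where `s' t` is the successor of `s t` in
the `t`-th sample. -/
noncomputable def tdIterate [DecidableEq S] [DecidableEq T] (L : LMDP S T A) (M₀ : Matrix S T ℝ)
    (s : ℕ → S) (r : ℕ → ℝ) (s' : ℕ → S ⊕ T) (α : ℕ → ℝ) : ℕ → Matrix S T ℝ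
  | 0 => M₀
  | t + 1 =>
    let M := tdIterate L M₀ s r s' α t
    M.updateRow (s t)
      ((1 - α t) • M (s t) + (α t * Real.exp (r t / L.temp)) • extend M (s' t))

/-- The samples `(s t, a t, r t, s' t)` are drawn under the default policy.  `ℱ t` is the history up
to and including the choice of `s t`; how `s t` is chosen from the history is unrestricted, so that
`s (t + 1) = s' t` within an episode and an arbitrary restart after termination are allowed.  The
reward is unbiased for the exponentiated state reward, with bounded conditional second moment; this
includes the deterministic reward `r t = R (s t)`. -/
structure IsDefaultSampling {Ω : Type*} {m : MeasurableSpace Ω} (L : LMDP S T A) (ℙ : Measure Ω)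
    (ℱ : Filtration ℕ m) (s : ℕ → Ω → S) (a : ℕ → Ω → A) (r : ℕ → Ω → ℝ)
    (s' : ℕ → Ω → S ⊕ T) : Prop where
  measurable_state : ∀ t x, MeasurableSet[ℱ t] {ω | s t ω = x}
  measurable_action : ∀ t b, MeasurableSet[ℱ (t + 1)] {ω | a t ω = b}
  measurable_reward : ∀ t, Measurable[ℱ (t + 1)] (r t)
  measurable_next : ∀ t y, MeasurableSet[ℱ (t + 1)] {ω | s' t ω = y}
  /-- Given the history, the action follows the default policy and the successor follows `P`. -/
  transition : ∀ t b y,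
    ℙ[{ω | a t ω = b ∧ s' t ω = y}.indicator (fun _ => (1 : ℝ)) | ℱ t]
      =ᵐ[ℙ] fun ω => L.defaultPolicy (s t ω) b * L.P (s t ω) b y
  /-- Given the history and the successor, `exp (r t / λ)` has mean `exp (R (s t) / λ)`. -/
  reward_mean : ∀ t,
    ℙ[fun ω => Real.exp (r t ω / L.temp) | ℱ t ⊔ MeasurableSpace.comap (s' t) ⊤]
      =ᵐ[ℙ] fun ω => Real.exp (L.R (Sum.inl (s t ω)) / L.temp)
  reward_sq_integrable : ∀ t, Integrable (fun ω => Real.exp (r t ω / L.temp) ^ 2) ℙ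
  reward_sq_bounded : ∃ C : ℝ, ∀ t,
    ℙ[fun ω => Real.exp (r t ω / L.temp) ^ 2 | ℱ t] ≤ᵐ[ℙ] fun _ => C

/-- Admissible step sizes: nonnegative, determined by the history, almost surely square summable,
and almost surely of infinite sum over the updates of each single state. -/
structure IsStepSize {S Ω : Type*} [DecidableEq S] {m : MeasurableSpace Ω} (ℙ : Measure Ω)
    (ℱ : Filtration ℕ m) (s : ℕ → Ω → S) (α : ℕ → Ω → ℝ) : Prop where
  measurable : ∀ t, Measurable[ℱ t] (α t)
  nonneg : ∀ t ω, 0 ≤ α t ω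
  sum_eq_top : ∀ᵐ ω ∂ℙ, ∀ x : S,
    Tendsto (fun n => ∑ t ∈ Finset.range n, if s t ω = x then α t ω else 0) atTop atTop
  sum_sq_lt_top : ∀ᵐ ω ∂ℙ, Summable fun t => α t ω ^ 2

end LMDP

/-! ### Deterministic averaging recursions with convergent noise. -/

namespace StochasticApproximation

/-! Each column of the terminal representation is the fixed point of an affine map that contracts
the sup norm by the largest `gain`, which is below one since rewards are negative and `S` is finite.
The update of a column is an asynchronous, noisy averaging step towards this map; its noise is a sum
over successors `y` of a weight known at time `t` times the martingale difference `deviation`.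

The weights involve the iterate, which is not known to be bounded. Dividing them by the running
scale makes them at most `α t` in absolute value, so the rescaled noise series converges almost
surely (`ae_exists_tendsto_sum`). The rest is pathwise. Convergence of the rescaled noise keeps the
scale bounded (`exists_scale_le`); since the scale is also monotone, Abel's test makes the true
noise series converge; and an asymptotic error bound `B` then improves to `γ * B`, repeatedly
(`tendsto_fixedPoint`). -/

theorem tendsto_zero_of_le_one_sub_mul {u a : ℕ → ℝ} (hu : ∀ t, 0 ≤ u t)
    (hsum : Tendsto (fun n => ∑ t ∈ Finset.range n, a t) atTop atTop)
    (hrec : ∀ᶠ t in atTop, u (t + 1) ≤ (1 - a t) * u t) : Tendsto u atTop (𝓝 0) := by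
  obtain ⟨T, hT⟩ := eventually_atTop.1 hrec
  set σ : ℕ → ℝ := fun n => ∑ t ∈ Finset.range n, a t with hσ
  -- The inequality `1 - a ≤ exp (-a)` holds for every real `a`, so no bounds on `a` are needed.
  have hbound : ∀ t, T ≤ t → u t ≤ u T * Real.exp (σ T - σ t) := by
    intro t ht
    induction t, ht using Nat.le_induction with
    | base => simp
    | succ t ht ih =>
      have hexp : Real.exp (σ T - σ (t + 1)) = Real.exp (σ T - σ t) * Real.exp (-a t) := by
        rw [← Real.exp_add]
        congr 1
        simp only [hσ, Finset.sum_range_succ]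
        ring
      calc u (t + 1) ≤ (1 - a t) * u t := hT t ht
        _ ≤ Real.exp (-a t) * u t := by
          refine mul_le_mul_of_nonneg_right ?_ (hu t)
          linarith [Real.add_one_le_exp (-a t)]
        _ ≤ Real.exp (-a t) * (u T * Real.exp (σ T - σ t)) :=
          mul_le_mul_of_nonneg_left ih (Real.exp_pos _).le
        _ = u T * Real.exp (σ T - σ (t + 1)) := by rw [hexp]; ring
  have hlim : Tendsto (fun t => u T * Real.exp (σ T - σ t)) atTop (𝓝 0) := by
    have h1 : Tendsto (fun t => σ T - σ t) atTop atBot := by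
      simp only [sub_eq_add_neg]
      exact tendsto_atBot_add_const_left _ (σ T) (tendsto_neg_atTop_atBot.comp hsum)
    simpa using (Real.tendsto_exp_atBot.comp h1).const_mul (u T)
  exact squeeze_zero' (Eventually.of_forall hu) (eventually_atTop.2 ⟨T, hbound⟩) hlim

/-- The excess over an eventual bound of the targets dies out. -/
theorem eventually_abs_le_of_averaging {z a c : ℕ → ℝ} {B : ℝ}
    (ha0 : ∀ t, 0 ≤ a t) (ha1 : ∀ᶠ t in atTop, a t ≤ 1)
    (hsum : Tendsto (fun n => ∑ t ∈ Finset.range n, a t) atTop atTop)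
    (hc : ∀ ε > 0, ∀ᶠ t in atTop, |c t| ≤ B + ε)
    (hrec : ∀ t, z (t + 1) = (1 - a t) * z t + a t * c t) :
    ∀ ε > 0, ∀ᶠ t in atTop, |z t| ≤ B + ε := by
  intro ε hε
  have hu : Tendsto (fun t => max (|z t| - (B + ε / 2)) 0) atTop (𝓝 0) := by
    refine tendsto_zero_of_le_one_sub_mul (fun t => le_max_right _ _) hsum ?_
    filter_upwards [ha1, hc (ε / 2) (by linarith)] with t h1 h2
    have h3 : |z (t + 1)| ≤ (1 - a t) * |z t| + a t * (B + ε / 2) := by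
      rw [hrec]
      refine (abs_add_le _ _).trans ?_
      rw [abs_mul, abs_mul, abs_of_nonneg (ha0 t), abs_of_nonneg (sub_nonneg.2 h1)]
      gcongr
      exact ha0 t
    have h4 := mul_le_mul_of_nonneg_left (le_max_left (|z t| - (B + ε / 2)) 0) (sub_nonneg.2 h1)
    refine max_le ?_ (mul_nonneg (sub_nonneg.2 h1) (le_max_right _ _))
    linarith
  filter_upwards [hu.eventually_lt_const (show (0 : ℝ) < ε / 2 by linarith)] with t ht
  have := (le_max_left (|z t| - (B + ε / 2)) 0).trans ht.le
  linarith

/-- Convergent additive noise does not change the asymptotic bound of an averaging recursion: it is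
absorbed by adding its tail sums to the iterate. -/
theorem eventually_abs_le_of_noisy_averaging {y a b n : ℕ → ℝ} {B ℓ : ℝ}
    (ha0 : ∀ t, 0 ≤ a t) (ha1 : ∀ᶠ t in atTop, a t ≤ 1)
    (hsum : Tendsto (fun n => ∑ t ∈ Finset.range n, a t) atTop atTop)
    (hb : ∀ ε > 0, ∀ᶠ t in atTop, |b t| ≤ B + ε)
    (hn : Tendsto (fun k => ∑ t ∈ Finset.range k, n t) atTop (𝓝 ℓ))
    (hrec : ∀ t, y (t + 1) = (1 - a t) * y t + a t * b t + n t) :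
    ∀ ε > 0, ∀ᶠ t in atTop, |y t| ≤ B + ε := by
  set N : ℕ → ℝ := fun k => ℓ - ∑ t ∈ Finset.range k, n t with hN
  have hN0 : Tendsto (fun t => |N t|) atTop (𝓝 0) := by
    simpa [hN] using (hn.const_sub ℓ).abs
  have hNs : ∀ t, N (t + 1) = N t - n t := by
    intro t; simp only [hN, Finset.sum_range_succ]; ring
  have hz := eventually_abs_le_of_averaging (z := fun t => y t + N t) (c := fun t => b t + N t)
    ha0 ha1 hsum (fun ε hε => by
      filter_upwards [hb (ε / 2) (by linarith), hN0.eventually_lt_const (half_pos hε)]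
        with t h1 h2
      linarith [abs_add_le (b t) (N t)])
    (fun t => by simp only [hrec, hNs]; ring)
  intro ε hε
  filter_upwards [hz (ε / 2) (by linarith), hN0.eventually_lt_const (half_pos hε)] with t h1 h2
  have : |y t| ≤ |y t + N t| + |N t| := by
    simpa using abs_sub (y t + N t) (N t)
  linarith

/-- Abel's test. -/
theorem exists_tendsto_sum_mul_of_monotone {G n : ℕ → ℝ} {ℓ C : ℝ} (hG : Monotone G)
    (hC : ∀ t, G t ≤ C) (hn : Tendsto (fun k => ∑ t ∈ Finset.range k, n t) atTop (𝓝 ℓ)) :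
    ∃ ℓ', Tendsto (fun k => ∑ t ∈ Finset.range k, G t * n t) atTop (𝓝 ℓ') := by
  have hlim : Tendsto G atTop (𝓝 (⨆ t, G t)) :=
    tendsto_atTop_ciSup hG ⟨C, by rintro _ ⟨t, rfl⟩; exact hC t⟩
  set N : ℕ → ℝ := fun k => ℓ - ∑ t ∈ Finset.range k, n t with hN
  have hN0 : Tendsto N atTop (𝓝 0) := by simpa [hN] using hn.const_sub ℓ
  obtain ⟨K, hK⟩ : ∃ K, ∀ t, |N t| ≤ K := by
    obtain ⟨K, hK⟩ := hN0.abs.bddAbove_range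
    exact ⟨K, fun t => hK ⟨t, rfl⟩⟩
  -- Summation by parts against tail sums: they are bounded and the increments of `G` have a finite
  -- sum, so the last series converges absolutely.
  have hid : ∀ k, ∑ t ∈ Finset.range k, G t * n t
      = G 0 * N 0 - G k * N k + ∑ t ∈ Finset.range k, (G (t + 1) - G t) * N (t + 1) := by
    intro k
    induction k with
    | zero => simp
    | succ k ih =>
      have : N (k + 1) = N k - n k := by simp only [hN, Finset.sum_range_succ]; ring
      rw [Finset.sum_range_succ, Finset.sum_range_succ, ih, this]
      ring
  have hsumm : Summable fun t => (G (t + 1) - G t) * N (t + 1) := by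
    refine Summable.of_norm_bounded (g := fun t => (G (t + 1) - G t) * K) ?_ fun t => ?_
    · refine Summable.mul_right _ (summable_of_sum_range_le (c := C - G 0)
        (fun t => sub_nonneg.2 (hG t.le_succ)) fun k => ?_)
      rw [Finset.sum_range_sub]
      linarith [hC k]
    · have h0 := sub_nonneg.2 (hG t.le_succ)
      rw [Real.norm_eq_abs, abs_mul, abs_of_nonneg h0]
      exact mul_le_mul_of_nonneg_left (hK _) h0
  simp only [hid]
  exact ⟨_, (tendsto_const_nhds.sub (hlim.mul hN0)).add hsumm.hasSum.tendsto_sum_nat⟩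

/-! ### Running scale and asynchronous contraction. -/

variable {ι : Type*} [Fintype ι]

/-- The running scale of a sequence: one plus the largest norm so far. -/
noncomputable def scale (x : ℕ → ι → ℝ) : ℕ → ℝ
  | 0 => 1 + ‖x 0‖
  | t + 1 => max (scale x t) (1 + ‖x (t + 1)‖)

theorem scale_mono (x : ℕ → ι → ℝ) : Monotone (scale x) :=
  monotone_nat_of_le_succ fun _ => le_max_left _ _

theorem one_add_norm_le_scale (x : ℕ → ι → ℝ) (t : ℕ) : 1 + ‖x t‖ ≤ scale x t := by
  cases t with
  | zero => exact le_rfl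
  | succ t => exact le_max_right _ _

theorem scale_pos (x : ℕ → ι → ℝ) (t : ℕ) : 0 < scale x t := by
  linarith [one_add_norm_le_scale x t, norm_nonneg (x t)]

/-- Iterates of a noisy averaging recursion towards a contraction stay bounded if the noise,
measured in units of the running scale, is summable. -/
theorem exists_scale_le {H : (ι → ℝ) → ι → ℝ} {γ : ℝ} (hγ0 : 0 ≤ γ) (hγ : γ < 1)
    {p : ι → ℝ} (hH : ∀ v, ‖H v - p‖ ≤ γ * ‖v - p‖)
    {x a n : ℕ → ι → ℝ} (ha0 : ∀ t i, 0 ≤ a t i) (ha1 : ∀ᶠ t in atTop, ∀ i, a t i ≤ 1)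
    {ℓ : ι → ℝ} (hn : ∀ i, Tendsto (fun k => ∑ t ∈ Finset.range k, n t i) atTop (𝓝 (ℓ i)))
    (hrec : ∀ t i, x (t + 1) i = (1 - a t i) * x t i + a t i * H (x t) i + scale x t * n t i) :
    ∃ C, ∀ t, scale x t ≤ C := by
  -- The tail noise is charged twice, in `hz` and again when it is removed in `hx`; this choice
  -- keeps `γ + 2 * δ` below one.
  set δ : ℝ := (1 - γ) / 4 with hδ
  have hδ0 : 0 < δ := by rw [hδ]; linarith
  set N : ℕ → ι → ℝ := fun k i => ℓ i - ∑ t ∈ Finset.range k, n t i with hN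
  have hN0 : ∀ᶠ t in atTop, ∀ i, |N t i| ≤ δ := by
    rw [eventually_all]
    intro i
    have : Tendsto (fun t => |N t i|) atTop (𝓝 0) := by
      simpa [hN] using ((hn i).const_sub (ℓ i)).abs
    filter_upwards [this.eventually_lt_const hδ0] with t ht using ht.le
  have hNs : ∀ t i, N (t + 1) i = N t i - n t i := by
    intro t i; simp only [hN, Finset.sum_range_succ]; ring
  obtain ⟨T, hT⟩ := eventually_atTop.1 (ha1.and hN0)
  have hG0 := scale_pos x
  have hHb : ∀ t i, |H (x t) i| ≤ 2 * ‖p‖ + γ * scale x t := by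
    intro t i
    have h1 : |H (x t) i| ≤ ‖H (x t)‖ := norm_le_pi_norm (H (x t)) i
    have h2 : ‖H (x t)‖ ≤ ‖H (x t) - p‖ + ‖p‖ := by
      simpa using norm_add_le (H (x t) - p) p
    have h3 : ‖x t - p‖ ≤ ‖x t‖ + ‖p‖ := norm_sub_le _ _
    have h4 := one_add_norm_le_scale x t
    nlinarith [hH (x t), norm_nonneg p, norm_nonneg (x t)]
  set K : ℝ := 2 * ‖p‖ + scale x T * (1 + δ) with hK
  -- Adding the scaled tail turns the recursion into plain averaging, up to an error from the growth
  -- of the scale. That error is at most `δ` times the increment of the scale, which the growth of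
  -- the right-hand side absorbs.
  have hz : ∀ t, T ≤ t → ∀ i, |x t i + scale x t * N t i| ≤ K + (γ + δ) * scale x t := by
    intro t ht
    induction t, ht using Nat.le_induction with
    | base =>
      intro i
      have h1 : |x T i| ≤ ‖x T‖ := norm_le_pi_norm (x T) i
      have h2 := one_add_norm_le_scale x T
      have h3 := (hT T le_rfl).2 i
      have h4 : |scale x T * N T i| ≤ scale x T * δ := by
        rw [abs_mul, abs_of_pos (hG0 T)]
        exact mul_le_mul_of_nonneg_left h3 (hG0 T).le
      have h5 : 0 ≤ (γ + δ) * scale x T := mul_nonneg (by linarith) (hG0 T).le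
      linarith [abs_add_le (x T i) (scale x T * N T i), norm_nonneg p]
    | succ t ht ih =>
      intro i
      have hmono := scale_mono x t.le_succ
      have hα1 := (hT t ht).1 i
      have e : x (t + 1) i + scale x (t + 1) * N (t + 1) i
          = (1 - a t i) * (x t i + scale x t * N t i)
            + a t i * (H (x t) i + scale x t * N t i)
            + (scale x (t + 1) - scale x t) * N (t + 1) i := by
        rw [hrec, hNs]; ring
      have b1 := ih i
      have b2 : |H (x t) i + scale x t * N t i| ≤ K + (γ + δ) * scale x t := by
        have h4 : |scale x t * N t i| ≤ scale x t * δ := by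
          rw [abs_mul, abs_of_pos (hG0 t)]
          exact mul_le_mul_of_nonneg_left ((hT t ht).2 i) (hG0 t).le
        have h5 : 0 ≤ scale x T * (1 + δ) := mul_nonneg (hG0 T).le (by linarith)
        linarith [abs_add_le (H (x t) i) (scale x t * N t i), hHb t i]
      have b3 : |(scale x (t + 1) - scale x t) * N (t + 1) i|
          ≤ (scale x (t + 1) - scale x t) * δ := by
        rw [abs_mul, abs_of_nonneg (sub_nonneg.2 hmono)]
        exact mul_le_mul_of_nonneg_left ((hT (t + 1) (by omega)).2 i) (sub_nonneg.2 hmono)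
      rw [e]
      refine (abs_add_three _ _ _).trans ?_
      rw [abs_mul, abs_mul (a t i), abs_of_nonneg (ha0 t i), abs_of_nonneg (sub_nonneg.2 hα1)]
      have c1 := mul_le_mul_of_nonneg_left b1 (sub_nonneg.2 hα1)
      have c2 := mul_le_mul_of_nonneg_left b2 (ha0 t i)
      have c3 : 0 ≤ γ * (scale x (t + 1) - scale x t) :=
        mul_nonneg hγ0 (sub_nonneg.2 hmono)
      linarith
  have hx : ∀ t, T ≤ t → ‖x t‖ ≤ K + (γ + 2 * δ) * scale x t := by
    intro t ht
    have hK0 : 0 ≤ K := add_nonneg (by positivity) (mul_nonneg (hG0 T).le (by linarith))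
    refine (pi_norm_le_iff_of_nonneg
      (add_nonneg hK0 (mul_nonneg (by linarith) (hG0 t).le))).2 fun i => ?_
    have h4 : |scale x t * N t i| ≤ scale x t * δ := by
      rw [abs_mul, abs_of_pos (hG0 t)]
      exact mul_le_mul_of_nonneg_left ((hT t ht).2 i) (hG0 t).le
    have h5 : |x t i| ≤ |x t i + scale x t * N t i| + |scale x t * N t i| := by
      simpa using abs_sub (x t i + scale x t * N t i) (scale x t * N t i)
    rw [Real.norm_eq_abs]
    linarith [hz t ht i]
  -- The scale occurs on both sides, on the right with a factor below one, so solving for it gives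
  -- the bound.
  have hG : ∀ t, T ≤ t → scale x t ≤ scale x T + 1 + K + (γ + 2 * δ) * scale x t := by
    have hK0 : 0 ≤ K := add_nonneg (by positivity) (mul_nonneg (hG0 T).le (by linarith))
    have hc : 0 ≤ γ + 2 * δ := by linarith
    intro t ht
    induction t, ht using Nat.le_induction with
    | base => linarith [mul_nonneg hc (hG0 T).le]
    | succ t ht ih =>
      have hmono := scale_mono x t.le_succ
      have := mul_le_mul_of_nonneg_left hmono hc
      refine (max_le ?_ ?_ : max (scale x t) (1 + ‖x (t + 1)‖) ≤ _)
      · linarith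
      · linarith [hx (t + 1) (by omega), hG0 T]
  refine ⟨(scale x T + 1 + K) / (1 - (γ + 2 * δ)), fun t => ?_⟩
  rw [le_div_iff₀ (by rw [hδ]; linarith)]
  rcases le_total T t with ht | ht
  · linarith [hG t ht]
  · have := mul_le_mul_of_nonneg_right (scale_mono x ht)
      (show 0 ≤ 1 - (γ + 2 * δ) by rw [hδ]; linarith)
    linarith [hG T le_rfl]

/-- Asynchronous stochastic approximation of the fixed point of a sup-norm contraction, along one
realization of the noise. -/
theorem tendsto_fixedPoint {H : (ι → ℝ) → ι → ℝ} {γ : ℝ} (hγ0 : 0 ≤ γ) (hγ : γ < 1)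
    {p : ι → ℝ} (hH : ∀ v, ‖H v - p‖ ≤ γ * ‖v - p‖)
    {x a n : ℕ → ι → ℝ} (ha0 : ∀ t i, 0 ≤ a t i) (ha1 : ∀ᶠ t in atTop, ∀ i, a t i ≤ 1)
    (hsum : ∀ i, Tendsto (fun k => ∑ t ∈ Finset.range k, a t i) atTop atTop)
    (hn : ∀ i, ∃ ℓ, Tendsto (fun k => ∑ t ∈ Finset.range k, n t i) atTop (𝓝 ℓ))
    (hrec : ∀ t i, x (t + 1) i = (1 - a t i) * x t i + a t i * H (x t) i + scale x t * n t i) :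
    Tendsto x atTop (𝓝 p) := by
  choose ℓ hℓ using hn
  obtain ⟨C, hC⟩ := exists_scale_le hγ0 hγ hH ha0 ha1 hℓ hrec
  -- If the error is asymptotically at most `B`, the targets `H (x t)` are asymptotically within `γ
  -- * B` of `p`, and averaging passes this on to the iterates.
  have step : ∀ B, 0 ≤ B → (∀ ε > 0, ∀ᶠ t in atTop, ‖x t - p‖ ≤ B + ε) →
      ∀ ε > 0, ∀ᶠ t in atTop, ‖x t - p‖ ≤ γ * B + ε := by
    intro B hB hQ
    have key : ∀ i, ∀ ε > 0, ∀ᶠ t in atTop, |x t i - p i| ≤ γ * B + ε := by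
      intro i
      obtain ⟨ℓ', hℓ'⟩ := exists_tendsto_sum_mul_of_monotone (scale_mono x) hC (hℓ i)
      refine eventually_abs_le_of_noisy_averaging (y := fun t => x t i - p i)
        (b := fun t => H (x t) i - p i) (fun t => ha0 t i)
        (ha1.mono fun t h => h i) (hsum i) (fun ε hε => ?_) hℓ' (fun t => ?_)
      · filter_upwards [hQ ε hε] with t ht
        have h1 : |H (x t) i - p i| ≤ ‖H (x t) - p‖ := norm_le_pi_norm (H (x t) - p) i
        have h2 := mul_le_mul_of_nonneg_left ht hγ0
        have h3 : γ * ε ≤ ε := by nlinarith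
        linarith [hH (x t)]
      · rw [hrec]; ring
    intro ε hε
    have := eventually_all.2 fun i => key i ε hε
    filter_upwards [this] with t ht
    exact (pi_norm_le_iff_of_nonneg (add_nonneg (mul_nonneg hγ0 hB) hε.le)).2 ht
  have hB0 : (0 : ℝ) ≤ C + ‖p‖ :=
    add_nonneg ((scale_pos x 0).le.trans (hC 0)) (norm_nonneg p)
  have hpow : ∀ k : ℕ, ∀ ε > 0, ∀ᶠ t in atTop, ‖x t - p‖ ≤ γ ^ k * (C + ‖p‖) + ε := by
    intro k
    induction k with
    | zero =>
      intro ε hε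
      refine Eventually.of_forall fun t => ?_
      linarith [norm_sub_le (x t) p, one_add_norm_le_scale x t, hC t]
    | succ k ih =>
      have := step _ (mul_nonneg (pow_nonneg hγ0 k) hB0) ih
      simpa only [pow_succ', mul_assoc] using this
  rw [Metric.tendsto_atTop']
  intro ε hε
  have hz : Tendsto (fun k : ℕ => γ ^ k * (C + ‖p‖)) atTop (𝓝 0) := by
    simpa using (tendsto_pow_atTop_nhds_zero_of_lt_one hγ0 hγ).mul_const (C + ‖p‖)
  obtain ⟨k, hk⟩ := (hz.eventually_lt_const (half_pos hε)).exists
  obtain ⟨T, hT⟩ := eventually_atTop.1 (hpow k (ε / 2) (half_pos hε))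
  refine ⟨T, fun t ht => ?_⟩
  rw [dist_eq_norm]
  linarith [hT t ht.le]

end StochasticApproximation

/-! ### Almost sure convergence of martingale transforms. -/

namespace StochasticApproximation

variable {Ω : Type*} {m : MeasurableSpace Ω} {μ : Measure Ω} [IsProbabilityMeasure μ]
  {ℱ : Filtration ℕ m}

/-- Increments of the partial sums are orthogonal to the past, so second moments add up to at most
`C * K`. The partial sums are thus a martingale bounded in `L²`, hence in `L¹`, and martingale
convergence applies. -/
theorem ae_exists_tendsto_sum_of_sum_sq_le {φ D : ℕ → Ω → ℝ} {K C : ℝ}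
    (hφ : ∀ t, Measurable[ℱ t] (φ t)) (hφK : ∀ n ω, ∑ t ∈ Finset.range n, φ t ω ^ 2 ≤ K)
    (hD : ∀ t, Measurable[ℱ (t + 1)] (D t)) (hD2 : ∀ t, MemLp (D t) 2 μ)
    (hmean : ∀ t, μ[D t | ℱ t] =ᵐ[μ] 0)
    (hC0 : 0 ≤ C) (hvar : ∀ t, μ[fun ω => D t ω ^ 2 | ℱ t] ≤ᵐ[μ] fun _ => C) :
    ∀ᵐ ω ∂μ, ∃ ℓ, Tendsto (fun n => ∑ t ∈ Finset.range n, φ t ω * D t ω) atTop (𝓝 ℓ) := by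
  have hφsq : ∀ t ω, φ t ω ^ 2 ≤ K := fun t ω =>
    (Finset.single_le_sum (f := fun k => φ k ω ^ 2) (fun k _ => sq_nonneg _)
      (Finset.self_mem_range_succ t)).trans (hφK (t + 1) ω)
  have hφb : ∀ t ω, ‖φ t ω‖ ≤ K + 1 := by
    intro t ω
    rw [Real.norm_eq_abs]
    nlinarith [hφsq t ω, sq_abs (φ t ω), sq_nonneg (|φ t ω| - 1), sq_nonneg (φ t ω)]
  have hφm : ∀ t, Measurable (φ t) := fun t => (hφ t).mono (ℱ.le t) le_rfl
  have hφi : ∀ t, Integrable (fun ω => φ t ω ^ 2) μ := fun t =>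
    Integrable.of_bound ((hφm t).pow_const 2).aestronglyMeasurable K
      (Eventually.of_forall fun ω => by
        rw [Real.norm_eq_abs, abs_of_nonneg (sq_nonneg _)]; exact hφsq t ω)
  set Y : ℕ → Ω → ℝ := fun t => φ t * D t with hY
  have hYL : ∀ t, MemLp (Y t) 2 μ := fun t =>
    (hD2 t).mul (MemLp.of_bound (p := ⊤) (hφm t).aestronglyMeasurable (K + 1)
      (Eventually.of_forall (hφb t)))
  have hY0 : ∀ t, μ[Y t | ℱ t] =ᵐ[μ] 0 := by
    intro t
    refine (condExp_stronglyMeasurable_mul_of_bound (ℱ.le t) (hφ t).stronglyMeasurable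
      ((hD2 t).integrable one_le_two) (K + 1) (Eventually.of_forall (hφb t))).trans ?_
    filter_upwards [hmean t] with ω h
    simp [h]
  have hYm : ∀ t, Measurable[ℱ (t + 1)] (Y t) := fun t =>
    ((hφ t).mono (ℱ.mono t.le_succ) le_rfl).mul (hD t)
  set M : ℕ → Ω → ℝ := fun n ω => ∑ t ∈ Finset.range n, Y t ω with hM
  have hMs : ∀ n, M (n + 1) = M n + Y n := by
    intro n; ext ω; simp [hM, Finset.sum_range_succ]
  have hMm : ∀ n, Measurable[ℱ n] (M n) := fun n =>
    Finset.measurable_sum _ fun t ht =>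
      (hYm t).mono (ℱ.mono (Finset.mem_range.1 ht)) le_rfl
  have hML : ∀ n, MemLp (M n) 2 μ := fun n => memLp_finsetSum _ fun t _ => hYL t
  have hmart : Martingale M ℱ μ := by
    refine martingale_of_condExp_sub_eq_zero_nat (fun n => (hMm n).stronglyMeasurable)
      (fun n => (hML n).integrable one_le_two) fun n => ?_
    rw [hMs, add_sub_cancel_left]
    exact hY0 n
  have hcross : ∀ n, ∫ ω, M n ω * Y n ω ∂μ = 0 := by
    intro n
    have hint : Integrable (M n * Y n) μ := (hML n).integrable_mul (hYL n)
    have h1 := condExp_mul_of_stronglyMeasurable_left (hMm n).stronglyMeasurable hint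
      ((hYL n).integrable one_le_two)
    have h2 : μ[M n * Y n | ℱ n] =ᵐ[μ] 0 := by
      filter_upwards [h1, hY0 n] with ω h h'
      simp [h, h']
    calc ∫ ω, M n ω * Y n ω ∂μ = ∫ ω, (μ[M n * Y n | ℱ n]) ω ∂μ :=
          (integral_condExp (ℱ.le n)).symm
      _ = 0 := by rw [integral_congr_ae h2]; simp
  have hYsq : ∀ n, ∫ ω, Y n ω ^ 2 ∂μ ≤ C * ∫ ω, φ n ω ^ 2 ∂μ := by
    intro n
    have h1 := condExp_stronglyMeasurable_mul_of_bound (μ := μ) (ℱ.le n)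
      ((hφ n).pow_const 2).stronglyMeasurable (hD2 n).integrable_sq K
      (Eventually.of_forall fun ω => by
        rw [Real.norm_eq_abs, abs_of_nonneg (sq_nonneg _)]; exact hφsq n ω)
    calc ∫ ω, Y n ω ^ 2 ∂μ
        = ∫ ω, ((fun ω => φ n ω ^ 2) * fun ω => D n ω ^ 2) ω ∂μ := by
          simp [hY, mul_pow]
      _ = ∫ ω, (μ[(fun ω => φ n ω ^ 2) * (fun ω => D n ω ^ 2) | ℱ n]) ω ∂μ :=
          (integral_condExp (ℱ.le n)).symm
      _ ≤ ∫ ω, C * φ n ω ^ 2 ∂μ := by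
          refine integral_mono_ae integrable_condExp ((hφi n).const_mul C) ?_
          filter_upwards [h1, hvar n] with ω h h'
          rw [h, Pi.mul_apply, mul_comm]
          exact mul_le_mul_of_nonneg_right h' (sq_nonneg _)
      _ = C * ∫ ω, φ n ω ^ 2 ∂μ := integral_const_mul _ _
  have hMsq : ∀ n, ∫ ω, M n ω ^ 2 ∂μ ≤ C * ∑ t ∈ Finset.range n, ∫ ω, φ t ω ^ 2 ∂μ := by
    intro n
    induction n with
    | zero => simp [hM]
    | succ n ih =>
      have e : ∀ ω, M (n + 1) ω ^ 2 = M n ω ^ 2 + 2 * (M n ω * Y n ω) + Y n ω ^ 2 := by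
        intro ω; rw [hMs, Pi.add_apply]; ring
      have i1 : Integrable (fun ω => M n ω ^ 2) μ := (hML n).integrable_sq
      have i2 : Integrable (fun ω => 2 * (M n ω * Y n ω)) μ :=
        ((hML n).integrable_mul (hYL n)).const_mul 2
      simp_rw [e]
      have i12 : Integrable (fun ω => M n ω ^ 2 + 2 * (M n ω * Y n ω)) μ := i1.add i2
      rw [integral_add i12 (hYL n).integrable_sq, integral_add i1 i2,
        integral_const_mul, hcross, Finset.sum_range_succ, mul_add]
      linarith [hYsq n]
  have hMK : ∀ n, ∫ ω, M n ω ^ 2 ∂μ ≤ C * K := by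
    intro n
    refine (hMsq n).trans (mul_le_mul_of_nonneg_left ?_ hC0)
    rw [← integral_finsetSum _ fun t _ => hφi t]
    refine (integral_mono (integrable_finsetSum _ fun t _ => hφi t) (integrable_const K)
      (hφK n)).trans ?_
    simp
  refine hmart.submartingale.exists_ae_tendsto_of_bdd (R := (C * K + 1).toNNReal) fun n => ?_
  change eLpNorm (M n) 1 μ ≤ _
  rw [eLpNorm_one_eq_lintegral_enorm,
    ← ofReal_integral_norm_eq_lintegral_enorm ((hML n).integrable one_le_two)]
  refine ENNReal.ofReal_le_ofReal ?_
  calc ∫ ω, ‖M n ω‖ ∂μ ≤ ∫ ω, (M n ω ^ 2 + 1) ∂μ := by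
        refine integral_mono ((hML n).integrable one_le_two).norm
          ((hML n).integrable_sq.add (integrable_const 1)) fun ω => ?_
        rw [Real.norm_eq_abs]
        nlinarith [sq_abs (M n ω), sq_nonneg (|M n ω| - 1), sq_nonneg (M n ω)]
    _ = ∫ ω, M n ω ^ 2 ∂μ + 1 := by
        rw [integral_add (hML n).integrable_sq (integrable_const 1)]; simp
    _ ≤ C * K + 1 := by linarith [hMK n]

/-- A martingale transform with almost surely square summable weights converges if the martingale
differences have uniformly bounded conditional variances. -/
theorem ae_exists_tendsto_sum {φ D : ℕ → Ω → ℝ} {C : ℝ}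
    (hφ : ∀ t, Measurable[ℱ t] (φ t)) (hφs : ∀ᵐ ω ∂μ, Summable fun t => φ t ω ^ 2)
    (hD : ∀ t, Measurable[ℱ (t + 1)] (D t)) (hD2 : ∀ t, MemLp (D t) 2 μ)
    (hmean : ∀ t, μ[D t | ℱ t] =ᵐ[μ] 0)
    (hC0 : 0 ≤ C) (hvar : ∀ t, μ[fun ω => D t ω ^ 2 | ℱ t] ≤ᵐ[μ] fun _ => C) :
    ∀ᵐ ω ∂μ, ∃ ℓ, Tendsto (fun n => ∑ t ∈ Finset.range n, φ t ω * D t ω) atTop (𝓝 ℓ) := by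
  set V : ℕ → Ω → ℝ := fun n ω => ∑ t ∈ Finset.range n, φ t ω ^ 2 with hV
  have hVm : ∀ t, Measurable[ℱ t] (V (t + 1)) := fun t =>
    Finset.measurable_sum _ fun k hk =>
      ((hφ k).mono (ℱ.mono (Nat.lt_succ_iff.1 (Finset.mem_range.1 hk))) le_rfl).pow_const 2
  -- Weights are switched off before their sum of squares exceeds `K`. The test uses `V (t + 1)`,
  -- which includes the current weight but is still known at time `t`. On almost every path some
  -- integer `K` makes the truncation inactive.
  have key : ∀ K : ℕ, ∀ᵐ ω ∂μ, ∃ ℓ, Tendsto (fun n => ∑ t ∈ Finset.range n,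
      (if V (t + 1) ω ≤ K then φ t ω else 0) * D t ω) atTop (𝓝 ℓ) := by
    intro K
    refine ae_exists_tendsto_sum_of_sum_sq_le (K := K) (ℱ := ℱ) (fun t => ?_) (fun n ω => ?_)
      hD hD2 hmean hC0 hvar
    · exact Measurable.ite (measurableSet_le (hVm t) measurable_const) (hφ t) measurable_const
    · have h0 : ∀ n, ∑ t ∈ Finset.range n, (if V (t + 1) ω ≤ K then φ t ω else 0) ^ 2 ≤ V n ω :=
        fun n => Finset.sum_le_sum fun t _ => by
          split_ifs
          · exact le_rfl
          · simpa using sq_nonneg (φ t ω)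
      induction n with
      | zero => simp
      | succ n ih =>
        by_cases h : V (n + 1) ω ≤ K
        · exact (h0 _).trans h
        · rw [Finset.sum_range_succ, if_neg h]
          simpa using ih
  filter_upwards [ae_all_iff.2 key, hφs] with ω h hs
  obtain ⟨K, hK⟩ := exists_nat_ge (∑' t, φ t ω ^ 2)
  have hVK : ∀ n, V n ω ≤ K := fun n =>
    (hs.sum_le_tsum _ fun t _ => sq_nonneg _).trans hK
  simpa only [hVK, if_true] using h K

end StochasticApproximation
-- Measurability and elementary bounds for the decision process.
namespace LMDP

theorem measurable_comp_of_fibers {Ω X : Type*} [Finite X] {m : MeasurableSpace Ω} {f : Ω → X}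
    (hf : ∀ x, MeasurableSet {ω | f ω = x}) (g : X → ℝ) : Measurable fun ω => g (f ω) := by
  let _ : MeasurableSpace X := ⊤
  exact (Measurable.of_discrete (f := g)).comp (measurable_to_countable' hf)

theorem extend_apply {S T : Type*} [DecidableEq T] (M : Matrix S T ℝ) (y : S ⊕ T) (τ : T) :
    extend M y τ = Sum.elim (fun x => M x τ) (fun σ => if σ = τ then 1 else 0) y := by
  cases y <;> rfl

/-- The summand one in the scale accounts for the terminal rows, whose entries are zero or one. -/
theorem abs_extend_le_scale {S T : Type*} [Fintype S] [DecidableEq T]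
    (x : ℕ → Matrix S T ℝ) (τ : T) (t : ℕ) (y : S ⊕ T) :
    |extend (x t) y τ| ≤ StochasticApproximation.scale (fun t x' => x t x' τ) t := by
  have h := StochasticApproximation.one_add_norm_le_scale (fun t x' => x t x' τ) t
  cases y with
  | inl z =>
    have : |x t z τ| ≤ ‖fun x' => x t x' τ‖ := norm_le_pi_norm (fun x' => x t x' τ) z
    change |x t z τ| ≤ _
    linarith
  | inr σ =>
    have := norm_nonneg fun x' => x t x' τ
    simp only [extend]
    split_ifs
    · rw [abs_one]; linarith
    · rw [abs_zero]; linarith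

variable {S T A : Type*} [Fintype S] [Fintype T] [Fintype A]

/-- The exponentiated reward of a non-terminal state. -/
noncomputable def gain (L : LMDP S T A) (x : S) : ℝ := Real.exp (L.R (Sum.inl x) / L.temp)

theorem gain_pos (L : LMDP S T A) (x : S) : 0 < L.gain x := Real.exp_pos _

theorem gain_lt_one (L : LMDP S T A) (x : S) : L.gain x < 1 :=
  Real.exp_lt_one_iff.mpr (div_neg_of_neg_of_pos (L.R_neg x) L.temp_pos)

theorem kernel_le_one (L : LMDP S T A) (x : S) (y : S ⊕ T) : L.kernel x y ≤ 1 := by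
  rw [← L.kernel_sum x]
  exact Finset.single_le_sum (fun y _ => L.kernel_nonneg x y) (Finset.mem_univ y)

/-! ### The sampling noise as martingale differences. -/

section Noise

variable {Ω : Type*} {m : MeasurableSpace Ω} {L : LMDP S T A} {ℙ : Measure Ω}
  {ℱ : Filtration ℕ m} {s : ℕ → Ω → S} {a : ℕ → Ω → A} {r : ℕ → Ω → ℝ}
  {s' : ℕ → Ω → S ⊕ T}

/-- The deviation of the reward-weighted indicator of the successor `y` from its conditional
mean. -/
noncomputable def deviation (L : LMDP S T A) (s : ℕ → Ω → S) (r : ℕ → Ω → ℝ)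
    (s' : ℕ → Ω → S ⊕ T) (y : S ⊕ T) (t : ℕ) (ω : Ω) : ℝ :=
  {ω | s' t ω = y}.indicator (fun ω => Real.exp (r t ω / L.temp)) ω
    - L.gain (s t ω) * L.kernel (s t ω) y

theorem deviation_sq_le (L : LMDP S T A) (s : ℕ → Ω → S) (r : ℕ → Ω → ℝ)
    (s' : ℕ → Ω → S ⊕ T) (y : S ⊕ T) (t : ℕ) (ω : Ω) :
    L.deviation s r s' y t ω ^ 2 ≤ 2 * Real.exp (r t ω / L.temp) ^ 2 + 2 := by
  have hv0 : 0 ≤ L.gain (s t ω) * L.kernel (s t ω) y :=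
    mul_nonneg (L.gain_pos _).le (L.kernel_nonneg _ _)
  have hv1 : L.gain (s t ω) * L.kernel (s t ω) y ≤ 1 :=
    mul_le_one₀ (L.gain_lt_one _).le (L.kernel_nonneg _ _) (L.kernel_le_one _ _)
  have he := Real.exp_pos (r t ω / L.temp)
  classical
  unfold deviation
  rw [Set.indicator_apply]
  split_ifs <;> nlinarith

namespace IsDefaultSampling

variable (h : L.IsDefaultSampling ℙ ℱ s a r s')
include h

theorem measurable_deviation (y : S ⊕ T) (t : ℕ) :
    Measurable[ℱ (t + 1)] (L.deviation s r s' y t) := by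
  refine Measurable.sub (Measurable.indicator ?_ (h.measurable_next t y)) ?_
  · exact Real.measurable_exp.comp ((h.measurable_reward t).div_const _)
  · exact (measurable_comp_of_fibers (h.measurable_state t)
      fun x => L.gain x * L.kernel x y).mono (ℱ.mono t.le_succ) le_rfl

theorem memLp_exp (t : ℕ) : MemLp (fun ω => Real.exp (r t ω / L.temp)) 2 ℙ := by
  refine (memLp_two_iff_integrable_sq ?_).2 (h.reward_sq_integrable t)
  exact (Real.measurable_exp.comp (((h.measurable_reward t).mono (ℱ.le _) le_rfl).div_const
    _)).aestronglyMeasurable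

theorem memLp_deviation [IsProbabilityMeasure ℙ] (y : S ⊕ T) (t : ℕ) : MemLp (L.deviation s r s' y t) 2 ℙ := by
  have hm : AEStronglyMeasurable (L.deviation s r s' y t) ℙ :=
    ((h.measurable_deviation y t).mono (ℱ.le _) le_rfl).aestronglyMeasurable
  refine (memLp_two_iff_integrable_sq hm).2 (Integrable.mono'
    (((h.reward_sq_integrable t).const_mul 2).add (integrable_const 2)) (hm.pow 2)
    (Eventually.of_forall fun ω => ?_))
  rw [Real.norm_eq_abs, abs_of_nonneg (sq_nonneg _)]
  exact L.deviation_sq_le s r s' y t ω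

theorem condExp_next [IsProbabilityMeasure ℙ] (y : S ⊕ T) (t : ℕ) :
    ℙ[{ω | s' t ω = y}.indicator (fun _ => (1 : ℝ)) | ℱ t]
      =ᵐ[ℙ] fun ω => L.kernel (s t ω) y := by
  have e : {ω | s' t ω = y}.indicator (fun _ => (1 : ℝ))
      = ∑ b, {ω | a t ω = b ∧ s' t ω = y}.indicator (fun _ => (1 : ℝ)) := by
    ext ω
    classical
    simp [Finset.sum_apply, Set.indicator_apply, ite_and]
  rw [e]
  refine (condExp_finsetSum (fun b _ => ?_) _).trans ?_
  · exact (integrable_const 1).indicator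
      (((ℱ.le _ _ (h.measurable_action t b))).inter (ℱ.le _ _ (h.measurable_next t y)))
  · filter_upwards [ae_all_iff.2 fun b => h.transition t b y] with ω hω
    simp [Finset.sum_apply, hω, kernel]

/-- Tower property through the history enlarged by the successor: there the indicator is measurable
and the exponentiated reward averages to the gain. Conditioning further on the history turns the
indicator into the kernel. -/
theorem condExp_deviation [IsProbabilityMeasure ℙ] (y : S ⊕ T) (t : ℕ) :
    ℙ[L.deviation s r s' y t | ℱ t] =ᵐ[ℙ] 0 := by
  have hs'm : ∀ y, MeasurableSet {ω | s' t ω = y} := fun y => ℱ.le _ _ (h.measurable_next t y)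
  have hcomap : MeasurableSpace.comap (s' t) ⊤ ≤ m := by
    let _ : MeasurableSpace (S ⊕ T) := ⊤
    exact (measurable_to_countable' hs'm : Measurable (s' t)).comap_le
  have hle : ℱ t ⊔ MeasurableSpace.comap (s' t) ⊤ ≤ m := sup_le (ℱ.le t) hcomap
  have hey := (h.memLp_exp t).integrable one_le_two
  have hgm : Measurable[ℱ t] fun ω => L.gain (s t ω) :=
    measurable_comp_of_fibers (h.measurable_state t) L.gain
  have hkm : Measurable[ℱ t] fun ω => L.gain (s t ω) * L.kernel (s t ω) y :=
    measurable_comp_of_fibers (h.measurable_state t) fun x => L.gain x * L.kernel x y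
  have hki : Integrable (fun ω => L.gain (s t ω) * L.kernel (s t ω) y) ℙ :=
    Integrable.of_bound (hkm.mono (ℱ.le t) le_rfl).aestronglyMeasurable 1
      (Eventually.of_forall fun ω => by
        rw [Real.norm_eq_abs, abs_of_nonneg (mul_nonneg (L.gain_pos _).le (L.kernel_nonneg _ _))]
        exact mul_le_one₀ (L.gain_lt_one _).le (L.kernel_nonneg _ _) (L.kernel_le_one _ _))
  have h1 : ℙ[{ω | s' t ω = y}.indicator (fun ω => Real.exp (r t ω / L.temp)) | ℱ t]
      =ᵐ[ℙ] fun ω => L.gain (s t ω) * L.kernel (s t ω) y := by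
    have hind : MeasurableSet[ℱ t ⊔ MeasurableSpace.comap (s' t) ⊤] {ω | s' t ω = y} :=
      (le_sup_right : MeasurableSpace.comap (s' t) ⊤ ≤ _) _ ⟨{y}, trivial, rfl⟩
    have h2 : ℙ[{ω | s' t ω = y}.indicator (fun ω => Real.exp (r t ω / L.temp)) |
        ℱ t ⊔ MeasurableSpace.comap (s' t) ⊤] =ᵐ[ℙ]
        (fun ω => L.gain (s t ω)) * {ω | s' t ω = y}.indicator (fun _ => (1 : ℝ)) := by
      refine (condExp_indicator hey hind).trans ?_
      filter_upwards [h.reward_mean t] with ω hω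
      classical
      simp only [Set.indicator_apply, Pi.mul_apply, hω, gain]
      split_ifs <;> simp
    refine (condExp_condExp_of_le le_sup_left hle).symm.trans ((condExp_congr_ae h2).trans ?_)
    refine (condExp_stronglyMeasurable_mul_of_bound (ℱ.le t) hgm.stronglyMeasurable
      ((integrable_const 1).indicator (hs'm y)) 1 (Eventually.of_forall fun ω => ?_)).trans ?_
    · rw [Real.norm_eq_abs, abs_of_pos (L.gain_pos _)]
      exact (L.gain_lt_one _).le
    · filter_upwards [h.condExp_next y t] with ω hω
      simp [hω]
  have h3 : ℙ[L.deviation s r s' y t | ℱ t] =ᵐ[ℙ] _ :=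
    condExp_sub (hey.indicator (hs'm y)) hki (ℱ t)
  rw [condExp_of_stronglyMeasurable (ℱ.le t) hkm.stronglyMeasurable hki] at h3
  filter_upwards [h3, h1] with ω e3 e1
  simp [e3, e1]

theorem exists_condExp_deviation_sq_le [IsProbabilityMeasure ℙ] : ∃ C : ℝ, 0 ≤ C ∧ ∀ y t,
    ℙ[fun ω => L.deviation s r s' y t ω ^ 2 | ℱ t] ≤ᵐ[ℙ] fun _ => C := by
  obtain ⟨C, hC⟩ := h.reward_sq_bounded
  -- The maximum avoids having to show that `C` itself is nonnegative.
  refine ⟨2 * max C 0 + 2, by positivity, fun y t => ?_⟩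
  have hi : Integrable ((2 : ℝ) • (fun ω => Real.exp (r t ω / L.temp) ^ 2)) ℙ :=
    (h.reward_sq_integrable t).smul (2 : ℝ)
  have h1 : ℙ[fun ω => L.deviation s r s' y t ω ^ 2 | ℱ t] ≤ᵐ[ℙ]
      ℙ[(2 : ℝ) • (fun ω => Real.exp (r t ω / L.temp) ^ 2) + fun _ => (2 : ℝ) | ℱ t] :=
    condExp_mono (h.memLp_deviation y t).integrable_sq (hi.add (integrable_const 2))
      (Eventually.of_forall fun ω => L.deviation_sq_le s r s' y t ω)
  have h2 := condExp_add hi (integrable_const (μ := ℙ) (2 : ℝ)) (ℱ t)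
  have h3 := condExp_smul (μ := ℙ) (2 : ℝ) (fun ω => Real.exp (r t ω / L.temp) ^ 2) (ℱ t)
  rw [condExp_const (ℱ.le t)] at h2
  filter_upwards [h1, h2, h3, hC t] with ω e1 e2 e3 e4
  rw [e2, Pi.add_apply, e3, Pi.smul_apply, smul_eq_mul] at e1
  linarith [le_max_left C 0]

end IsDefaultSampling

end Noise

/-! ### The column maps and convergence of the iterates. -/

section Iterate

variable [DecidableEq T]

/-- The affine map whose fixed point is column `τ` of the terminal representation. -/
noncomputable def columnMap (L : LMDP S T A) (τ : T) (v : S → ℝ) (x : S) : ℝ :=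
  L.gain x * ∑ y, L.kernel x y * Sum.elim v (fun σ => if σ = τ then 1 else 0) y

/-- Terminal contributions cancel in the difference, and the non-terminal part of each kernel row
has mass at most one. -/
theorem norm_columnMap_sub_le (L : LMDP S T A) (τ : T) {γ : ℝ} (hγ0 : 0 ≤ γ)
    (hγ : ∀ x, L.gain x ≤ γ) (v w : S → ℝ) :
    ‖L.columnMap τ v - L.columnMap τ w‖ ≤ γ * ‖v - w‖ := by
  refine (pi_norm_le_iff_of_nonneg (mul_nonneg hγ0 (norm_nonneg _))).2 fun x => ?_
  have e : (L.columnMap τ v - L.columnMap τ w) x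
      = L.gain x * ∑ z, L.kernel x (Sum.inl z) * (v z - w z) := by
    simp only [columnMap, Pi.sub_apply, ← mul_sub, Fintype.sum_sum_type, Sum.elim_inl,
      Sum.elim_inr, add_sub_add_right_eq_sub, ← Finset.sum_sub_distrib]
  have hk : ∑ z, L.kernel x (Sum.inl z) ≤ 1 := by
    rw [← L.kernel_sum x, Fintype.sum_sum_type]
    exact le_add_of_nonneg_right (Finset.sum_nonneg fun _ _ => L.kernel_nonneg _ _)
  rw [e, norm_mul, Real.norm_of_nonneg (L.gain_pos x).le]
  refine mul_le_mul (hγ x) ?_ (norm_nonneg _) hγ0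
  calc ‖∑ z, L.kernel x (Sum.inl z) * (v z - w z)‖
      ≤ ∑ z, L.kernel x (Sum.inl z) * ‖v - w‖ := by
        refine norm_sum_le_of_le _ fun z _ => ?_
        rw [norm_mul, Real.norm_of_nonneg (L.kernel_nonneg _ _)]
        exact mul_le_mul_of_nonneg_left (norm_le_pi_norm (v - w) z) (L.kernel_nonneg _ _)
    _ ≤ ‖v - w‖ := by
        rw [← Finset.sum_mul]
        exact mul_le_of_le_one_left (norm_nonneg _) hk

variable [DecidableEq S]

theorem columnMap_terminalRep (L : LMDP S T A) (τ : T) :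
    L.columnMap τ (fun x => L.terminalRep x τ) = fun x => L.terminalRep x τ := by
  have hdet := (Matrix.isUnit_iff_isUnit_det _).1 L.isUnit_one_sub_DS
  have h : L.terminalRep = L.DS * L.terminalRep + L.DT := by
    have h1 : (1 - L.DS) * L.terminalRep = L.DT := by
      rw [terminalRep, ← Matrix.mul_assoc, Matrix.mul_nonsing_inv _ hdet, Matrix.one_mul]
    rw [← h1, Matrix.sub_mul, Matrix.one_mul, add_sub_cancel]
  ext x
  conv_rhs => rw [h]
  have hS : ∀ z, L.DS x z = L.gain x * L.kernel x (Sum.inl z) := fun z => by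
    simp [DS, RS, PS, gain, Matrix.diagonal_mul]
  have hT : L.DT x τ = L.gain x * L.kernel x (Sum.inr τ) := by
    simp [DT, RS, PT, gain, Matrix.diagonal_mul]
  simp [columnMap, Matrix.add_apply, Matrix.mul_apply, hS, hT, mul_add, Finset.mul_sum, mul_assoc]

/-- Treating unvisited rows as having step size zero gives one recursion for all states, as
asynchronous approximation requires. -/
theorem tdIterate_succ_apply (L : LMDP S T A) (M₀ : Matrix S T ℝ) (s : ℕ → S) (r : ℕ → ℝ)
    (s' : ℕ → S ⊕ T) (α : ℕ → ℝ) (t : ℕ) (x : S) (τ : T) :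
    L.tdIterate M₀ s r s' α (t + 1) x τ = L.tdIterate M₀ s r s' α t x τ
      + (if s t = x then α t else 0) * (Real.exp (r t / L.temp)
          * extend (L.tdIterate M₀ s r s' α t) (s' t) τ - L.tdIterate M₀ s r s' α t x τ) := by
  simp only [tdIterate]
  by_cases hx : s t = x
  · subst hx
    simp only [Matrix.updateRow_self, Pi.add_apply, Pi.smul_apply, smul_eq_mul, if_true]
    ring
  · rw [Matrix.updateRow_ne (Ne.symm hx), if_neg hx]
    ring

variable {Ω : Type*} {m : MeasurableSpace Ω} {L : LMDP S T A} {ℙ : Measure Ω}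
  {ℱ : Filtration ℕ m} {s : ℕ → Ω → S} {a : ℕ → Ω → A} {r : ℕ → Ω → ℝ}
  {s' : ℕ → Ω → S ⊕ T} {α : ℕ → Ω → ℝ} {M₀ : Ω → Matrix S T ℝ}

theorem IsDefaultSampling.measurable_tdIterate (h : L.IsDefaultSampling ℙ ℱ s a r s')
    (hα : ∀ t, Measurable[ℱ t] (α t)) (hM₀ : ∀ x τ, Measurable[ℱ 0] fun ω => M₀ ω x τ)
    (t : ℕ) (x : S) (τ : T) :
    Measurable[ℱ t] fun ω => L.tdIterate (M₀ ω) (fun k => s k ω) (fun k => r k ω)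
      (fun k => s' k ω) (fun k => α k ω) t x τ := by
  classical
  induction t generalizing x τ with
  | zero => exact hM₀ x τ
  | succ t ih =>
    have ih' := fun x τ => (ih x τ).mono (ℱ.mono t.le_succ) le_rfl
    simp only [tdIterate_succ_apply]
    refine (ih' x τ).add (Measurable.mul ?_ (Measurable.sub (Measurable.mul ?_ ?_) (ih' x τ)))
    · exact Measurable.ite (ℱ.mono t.le_succ _ (h.measurable_state t x))
        ((hα t).mono (ℱ.mono t.le_succ) le_rfl) measurable_const
    · exact Real.measurable_exp.comp ((h.measurable_reward t).div_const _)
    -- The row index is random, so measurability is checked on each of the finitely many values of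
    -- the successor.
    · have e : ∀ (M : Ω → Matrix S T ℝ), (fun ω => extend (M ω) (s' t ω) τ)
          = fun ω => ∑ y, if s' t ω = y then extend (M ω) y τ else 0 := by
        intro M; ext ω; simp
      rw [e]
      refine Finset.measurable_sum _ fun y _ =>
        Measurable.ite (h.measurable_next t y) ?_ measurable_const
      cases y with
      | inl z => exact ih' z τ
      | inr σ => exact measurable_const

theorem measurable_scale {ι : Type*} [Fintype ι] {x : ℕ → Ω → ι → ℝ}
    (hx : ∀ t i, Measurable[ℱ t] fun ω => x t ω i) (t : ℕ) :
    Measurable[ℱ t] fun ω => StochasticApproximation.scale (fun k => x k ω) t := by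
  have hn : ∀ t, Measurable[ℱ t] fun ω => 1 + ‖x t ω‖ := fun t =>
    measurable_const.add (measurable_norm.comp (@measurable_pi_lambda _ _ _ (ℱ t) _ _ (hx t)))
  induction t with
  | zero => exact hn 0
  | succ t ih => exact (ih.mono (ℱ.mono t.le_succ) le_rfl).max (hn (t + 1))

theorem IsDefaultSampling.ae_tendsto_column [IsProbabilityMeasure ℙ]
    (h : L.IsDefaultSampling ℙ ℱ s a r s')
    (hα : IsStepSize ℙ ℱ s α) (hM₀ : ∀ x τ, Measurable[ℱ 0] fun ω => M₀ ω x τ) (τ : T) :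
    ∀ᵐ ω ∂ℙ, Tendsto (fun t x => L.tdIterate (M₀ ω) (fun k => s k ω) (fun k => r k ω)
      (fun k => s' k ω) (fun k => α k ω) t x τ) atTop (𝓝 fun x => L.terminalRep x τ) := by
  set M : ℕ → Ω → Matrix S T ℝ := fun t ω => L.tdIterate (M₀ ω) (fun k => s k ω)
    (fun k => r k ω) (fun k => s' k ω) (fun k => α k ω) t with hM
  set G : ℕ → Ω → ℝ := fun t ω =>
    StochasticApproximation.scale (fun k x => M k ω x τ) t with hG
  have hMm : ∀ t x τ, Measurable[ℱ t] fun ω => M t ω x τ :=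
    h.measurable_tdIterate hα.measurable hM₀
  have hGm : ∀ t, Measurable[ℱ t] (G t) :=
    measurable_scale (x := fun k ω x => M k ω x τ) fun t x => hMm t x τ
  have hGpos : ∀ t ω, 0 < G t ω := fun t ω => StochasticApproximation.scale_pos _ t
  have hext : ∀ t ω y, |extend (M t ω) y τ / G t ω| ≤ 1 := by
    intro t ω y
    rw [abs_div, abs_of_pos (hGpos t ω), div_le_one (hGpos t ω)]
    exact abs_extend_le_scale (fun k => M k ω) τ t y
  obtain ⟨C, hC0, hC⟩ := h.exists_condExp_deviation_sq_le
  -- With the successor `y` fixed, the weight depends only on the history; the randomness of the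
  -- sample sits entirely in `deviation`.
  have hconv : ∀ᵐ ω ∂ℙ, ∀ x y, ∃ ℓ, Tendsto (fun n => ∑ t ∈ Finset.range n,
      ((if s t ω = x then α t ω else 0) * (extend (M t ω) y τ / G t ω))
        * L.deviation s r s' y t ω) atTop (𝓝 ℓ) := by
    rw [ae_all_iff]; intro x
    rw [ae_all_iff]; intro y
    refine StochasticApproximation.ae_exists_tendsto_sum (ℱ := ℱ) (fun t => ?_) ?_
      (h.measurable_deviation y) (h.memLp_deviation y) (h.condExp_deviation y) hC0 (hC y)
    · refine (Measurable.ite (h.measurable_state t x) (hα.measurable t) measurable_const).mul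
        (Measurable.div ?_ (hGm t))
      cases y with
      | inl z => exact hMm t z τ
      | inr σ => exact measurable_const
    · filter_upwards [hα.sum_sq_lt_top] with ω hω
      refine hω.of_nonneg_of_le (fun t => sq_nonneg _) fun t => ?_
      rw [mul_pow]
      have h1 : (extend (M t ω) y τ / G t ω) ^ 2 ≤ 1 := (sq_le_one_iff_abs_le_one _).2 (hext t ω y)
      have h2 : (if s t ω = x then α t ω else 0) ^ 2 ≤ α t ω ^ 2 := by
        split_ifs
        · exact le_rfl
        · simpa using sq_nonneg (α t ω)
      nlinarith [sq_nonneg (if s t ω = x then α t ω else 0)]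
  obtain ⟨ω₀⟩ : Nonempty Ω := nonempty_of_isProbabilityMeasure ℙ
  have : Nonempty S := ⟨s 0 ω₀⟩
  obtain ⟨x₀, hx₀⟩ := Finite.exists_max L.gain
  filter_upwards [hconv, hα.sum_eq_top, hα.sum_sq_lt_top] with ω hn hsum hsq
  have hα1 : ∀ᶠ t in atTop, α t ω ≤ 1 := by
    filter_upwards [hsq.tendsto_atTop_zero.eventually_le_const one_pos] with t ht
    nlinarith
  refine StochasticApproximation.tendsto_fixedPoint (H := L.columnMap τ) (L.gain_pos x₀).le
    (L.gain_lt_one x₀) (fun v => ?_) (a := fun t x => if s t ω = x then α t ω else 0)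
    (n := fun t x => ∑ y, ((if s t ω = x then α t ω else 0) * (extend (M t ω) y τ / G t ω))
        * L.deviation s r s' y t ω) (fun t x => ?_) ?_ hsum (fun x => ?_) (fun t x => ?_)
  · conv_lhs => rw [← L.columnMap_terminalRep τ]
    exact L.norm_columnMap_sub_le τ (L.gain_pos x₀).le hx₀ _ _
  · split_ifs
    · exact hα.nonneg t ω
    · exact le_rfl
  · filter_upwards [hα1] with t ht x
    split_ifs
    · exact ht
    · exact zero_le_one
  · choose ℓ hℓ using hn x
    refine ⟨∑ y, ℓ y, ?_⟩
    simp_rw [Finset.sum_comm (s := Finset.range _)]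
    exact tendsto_finsetSum _ fun y _ => hℓ y
  -- Summing over `y` recovers the sampled target minus its conditional mean, which is the column
  -- map at the visited state.
  · have hnoise : ∑ y, extend (M t ω) y τ * L.deviation s r s' y t ω
        = Real.exp (r t ω / L.temp) * extend (M t ω) (s' t ω) τ
          - L.columnMap τ (fun x => M t ω x τ) (s t ω) := by
      classical
      simp only [deviation, columnMap, mul_sub, Finset.sum_sub_distrib, Set.indicator_apply,
        Set.mem_ofPred_eq, mul_ite, mul_zero, Finset.sum_ite_eq, Finset.mem_univ, if_true,
        ← extend_apply, Finset.mul_sum]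
      congr 1
      · ring
      · exact Finset.sum_congr rfl fun y _ => by ring
    have hscale : G t ω * ∑ y, ((if s t ω = x then α t ω else 0)
          * (extend (M t ω) y τ / G t ω)) * L.deviation s r s' y t ω
        = (if s t ω = x then α t ω else 0) *
          ∑ y, extend (M t ω) y τ * L.deviation s r s' y t ω := by
      rw [Finset.mul_sum, Finset.mul_sum]
      refine Finset.sum_congr rfl fun y _ => ?_
      have := (hGpos t ω).ne'
      field_simp
    change M (t + 1) ω x τ = (1 - _) * M t ω x τ + _ + G t ω * _
    rw [hscale, hnoise]
    have hs := L.tdIterate_succ_apply (M₀ ω) (fun k => s k ω) (fun k => r k ω)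
      (fun k => s' k ω) (fun k => α k ω) t x τ
    refine hs.trans ?_
    -- The noise identity concerns the visited state rather than `x`; when they differ the step size
    -- vanishes and nothing is left to compare.
    by_cases hx : s t ω = x
    · subst hx
      simp only [if_true, hM]
      ring
    · simp only [if_neg hx, hM]
      ring

end Iterate

end LMDP

theorem theorem4p2 {S T A : Type*} [Fintype S] [Fintype T] [Fintype A]
    [DecidableEq S] [DecidableEq T] (L : LMDP S T A)
    {Ω : Type*} {m : MeasurableSpace Ω} (ℙ : Measure Ω) [IsProbabilityMeasure ℙ]
    (ℱ : Filtration ℕ m)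
    (s : ℕ → Ω → S) (a : ℕ → Ω → A) (r : ℕ → Ω → ℝ) (s' : ℕ → Ω → S ⊕ T)
    (hsample : L.IsDefaultSampling ℙ ℱ s a r s')
    (α : ℕ → Ω → ℝ) (hα : LMDP.IsStepSize ℙ ℱ s α)
    (M₀ : Ω → Matrix S T ℝ) (hM₀ : ∀ x τ, Measurable[ℱ 0] fun ω => M₀ ω x τ) :
    ∀ᵐ ω ∂ℙ, Tendsto
      (fun t => L.tdIterate (M₀ ω) (fun k => s k ω) (fun k => r k ω) (fun k => s' k ω)
        (fun k => α k ω) t)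
      atTop (𝓝 L.terminalRep) := by
  filter_upwards [ae_all_iff.2 fun τ => hsample.ae_tendsto_column hα hM₀ τ] with ω hω
  refine tendsto_pi_nhds.2 fun x => tendsto_pi_nhds.2 fun τ => ?_
  exact (tendsto_pi_nhds.1 (hω τ)) x
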